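/- **Setting.** Let $X$ be a measurable space and $\mathcal H$ a class of measurable hypotheses $h:X\to\{0,1\}$ with VC-dimension $\mathrm{VC}(\mathcal H)\in\mathbb N\cup\{\infty\}$. Given a target $c\in\mathcal H$ and probability distributions $D^+$ on $\{c=1\}$ and $D^-$ on $\{c=0\}$, a call of the noisy oracle $\mathrm{POS}^\lambda$ (resp. $\mathrm{NEG}^\lambda$) returns, independently on each call, with probability $1-\lambda$ a point drawn from $D^+$ (resp. $D^-$), and with probability $\lambda$ an arbitrary point chosen by an adversary who knows $c$, $D^+$, $D^-$, the algorithm, the previous answers and the current contents of the algorithm's memory. An *$r$-pass online algorithm with $s$ bits of space* has a working memory with $2^s$ possible contents. In its first pass it requests $m$ labelled examples one after the other, each from the oracle of its choice; it then reads the same stream of $m$ examples again, in the same order, in $r-1$ further passes. When it reads an example it updates its memory as a function of the memory contents, the example, the pass number, the position in the stream and its random bits (which are not charged as memory). At the end it outputs a hypothesis $h\in\mathcal H$ determined by the final memory contents and the random bits. It is a *robust PAC learner with error rate $\epsilon$, failure probability $\delta$ and outlier rate $\lambda$* if, for all $c, D^+, D^-$ as above and every adversary, with probability at least $1-\delta$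 both errors $D^+(h=0)$ and $D^-(h=1)$ are less than $\epsilon$. **Theorem.** For every $\epsilon_0<\tfrac12$ there is a constant $C>0$ such that for every $\delta\in(0,1)$ there is a $d_0$ for which the following holds. Let $0<\epsilon\le\epsilon_0$, $0\le\lambda<\epsilon$, let $d\ge d_0$ be an integer with $d\le\mathrm{VC}(\mathcal H)$ (for instance $d=\mathrm{VC}(\mathcal H)$ if this is finite), and let $r\ge1$. Then every $r$-pass online robust PAC learner of $\mathcal H$ with error rate $\epsilon$, failure probability $\delta$ and outlier rate $\lambda$ (for any number $m$ of examples) uses space $$ s\;\ge\; C\,\frac{1-\epsilon}{1-\lambda}\cdot\frac dr . $$ That is, its space complexity is $\Omega\!\left(\frac{1-\epsilon}{1-\lambda}\frac dr\right)$. -/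

import Mathlib

open MeasureTheory

namespace RobustPAC

/-- The class `H` of `{0,1}`-valued hypotheses (`true` = positive) shatters the finite set `S`:
every subset of `S` is cut out of `S` by some member of `H`. -/
def Shatters {X : Type*} (H : Set (X → Bool)) (S : Finset X) : Prop :=
  ∀ T ⊆ S, ∃ h ∈ H, ∀ x ∈ S, (h x = true ↔ x ∈ T)

/-- The VC-dimension: the supremum, in `ℕ ∪ {∞}`, of the sizes of the finite shattered sets. -/
noncomputable def vcDim {X : Type*} (H : Set (X → Bool)) : ℕ∞ :=
  ⨆ (S : Finset X) (_ : Shatters H S), (S.card : ℕ∞)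

/-- The contents of a working memory of `s` bits. -/
abbrev Memory (s : ℕ) : Type := Fin s → Bool

/-- A streaming (online) learner with `s` bits of working memory for the hypothesis class `H`.
`Ω` is the set of values of its source of random bits; these bits can be read at any time and are
not charged as memory. The learner may also use the number of the current pass and the position
in the stream for free. A labelled example is a pair `(x, b)`, where `b = true` if `x` was
returned by the positive oracle and `b = false` if it was returned by the negative oracle.

* `init`: the initial contents of the memory;
* `query ω i q`: the oracle (`true` = positive, `false` = negative) from which the `i`-th example
  of the stream is requested when the memory contents are `q`;
* `step ω p i q z`: the new contents of the memory, when the example `z` is read at position `i`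
  in pass `p` and the memory contents are `q` (passes and positions are counted from `0`);
* `out`: the hypothesis of `H` that is described by the final contents of the memory. -/
structure StreamLearner {X : Type*} (Ω : Type*) (H : Set (X → Bool)) (s : ℕ) where
  init : Ω → Memory s
  query : Ω → ℕ → Memory s → Bool
  step : Ω → ℕ → ℕ → Memory s → X × Bool → Memory s
  out : Ω → Memory s → H

/-- What happens at one call of a noisy oracle, before the adversary acts: `isError` tells whether
an error occurs, `pos` and `neg` are the examples that the faithful positive and the faithful
negative oracle would return. It is given as a nested pair. -/
abbrev Draw (X : Type*) : Type _ := Bool × X × X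

/-- The record of one answered call of a noisy oracle: the returned point, the oracle that was
called, and whether the answer was an error. -/
structure Answer (X : Type*) where
  point : X
  label : Bool
  isError : Bool

/-- The labelled example that the learner sees. -/
def Answer.toExample {X : Type*} (a : Answer X) : X × Bool := (a.point, a.label)

/-- A malicious adversary: it chooses the point that is returned at an erroneous call, knowing the
whole history of previous answers, the current contents of the memory of the learner, and which
oracle is called. No assumption is made on it. -/
abbrev Adversary (X : Type*) (s : ℕ) : Type _ := List (Answer X) → Memory s → Bool → X

section Run

variable {X Ω : Type*} {H : Set (X → Bool)} {s : ℕ}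

/-- One request of an example during the first pass. The state is the contents of the memory
together with the list of the answers received so far. -/
def requestStep (A : StreamLearner Ω H s) (adv : Adversary X s) (ω : Ω)
    (st : Memory s × List (Answer X)) (ζ : Draw X) : Memory s × List (Answer X) :=
  let i := st.2.length
  let b := A.query ω i st.1
  let x := if ζ.1 then adv st.2 st.1 b else if b then ζ.2.1 else ζ.2.2
  (A.step ω 0 i st.1 (x, b), st.2 ++ [⟨x, b, ζ.1⟩])

/-- The first pass, in which the stream is obtained from the noisy oracles, one example after the
other: the memory at its end, and the list of all answers. -/
def firstPass (A : StreamLearner Ω H s) (adv : Adversary X s) (ω : Ω) (draws : List (Draw X)) :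
    Memory s × List (Answer X) :=
  draws.foldl (requestStep A adv ω) (A.init ω, [])

/-- Pass number `p` over a given stream, begun with memory contents `q`. -/
def laterPass (A : StreamLearner Ω H s) (ω : Ω) (stream : List (X × Bool)) (p : ℕ)
    (q : Memory s) : Memory s :=
  stream.zipIdx.foldl (fun q' z => A.step ω p z.2 q' z.1) q

/-- The contents of the memory after the first pass and `n` further passes over the same
stream. -/
def memoryAfter (A : StreamLearner Ω H s) (adv : Adversary X s) (ω : Ω)
    (draws : List (Draw X)) : ℕ → Memory s
  | 0 => (firstPass A adv ω draws).1
  | n + 1 => laterPass A ω ((firstPass A adv ω draws).2.map Answer.toExample) (n + 1)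
      (memoryAfter A adv ω draws n)

/-- The hypothesis that the learner outputs after `r ≥ 1` passes. -/
def output (A : StreamLearner Ω H s) (adv : Adversary X s) (ω : Ω) (draws : List (Draw X))
    (r : ℕ) : X → Bool :=
  (A.out ω (memoryAfter A adv ω draws (r - 1)) : X → Bool)

end Run

/-- The law of a coin that shows `true` with probability `lam` (for `0 ≤ lam ≤ 1`). -/
noncomputable def coin (lam : ℝ) : Measure Bool :=
  ENNReal.ofReal lam • Measure.dirac true + ENNReal.ofReal (1 - lam) • Measure.dirac false

/-- The law of `m` independent calls of the oracles with error probability `lam`, where the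
faithful examples are drawn from `Dpos` and `Dneg`. -/
noncomputable def drawLaw {X : Type*} [MeasurableSpace X] (lam : ℝ) (Dpos Dneg : Measure X)
    (m : ℕ) : Measure (Fin m → Draw X) :=
  Measure.pi fun _ => (coin lam).prod (Dpos.prod Dneg)

/-- `h` has error less than `ε` on the positive and on the negative examples. -/
def ErrorLT {X : Type*} [MeasurableSpace X] (Dpos Dneg : Measure X) (h : X → Bool) (ε : ℝ) :
    Prop :=
  Dpos {x | h x = false} < ENNReal.ofReal ε ∧ Dneg {x | h x = true} < ENNReal.ofReal ε

/-- `A`, run with `r` passes over a stream of `m` examples, is a robust PAC learner of `H` with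
error rate `ε`, failure probability `δ` and outlier rate `lam`: for every target `c ∈ H`, all
distributions `Dpos`, `Dneg` of the positive and of the negative examples of `c`, and every
adversary, the output hypothesis fails to have error less than `ε` with probability at most `δ`.
The probability is over the random bits of the learner, which have law `P`, and over the draws.
(`Measure` is an outer measure, so the inequality also makes sense if the failure event is not
measurable; then it lies in a measurable event of probability at most `δ`.) -/
def IsRobustPACLearner {X Ω : Type*} [MeasurableSpace X] [MeasurableSpace Ω] (P : Measure Ω)
    {H : Set (X → Bool)} {s : ℕ} (A : StreamLearner Ω H s) (r m : ℕ) (ε δ lam : ℝ) : Prop :=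
  ∀ c ∈ H, ∀ Dpos Dneg : Measure X, IsProbabilityMeasure Dpos → IsProbabilityMeasure Dneg →
    Dpos {x | c x = true} = 1 → Dneg {x | c x = false} = 1 →
    ∀ adv : Adversary X s,
      (P.prod (drawLaw lam Dpos Dneg m))
        {w | ¬ ErrorLT Dpos Dneg (output A adv w.1 (List.ofFn w.2) r) ε} ≤ ENNReal.ofReal δ

end RobustPAC

/-!
The output of the learner is one of the `2 ^ s` hypotheses that its memory can describe, and this
family depends on the random bits alone. So the learner yields a random family of `2 ^ s`
hypotheses that, for every target and all distributions, contains an accurate hypothesis with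
probability at least `1 - δ`. Such families are large: arrange `2k ≤ d` shattered points in `k`
pairs and consider the `2 ^ k` targets that make exactly one point of each pair positive, with the
uniform distributions on their positive and on their negative points. If the target is uniformly
random, the advantage of a fixed hypothesis is a sum of `k` independent symmetric variables with
values in `{-1, 0, 1}`, and accuracy requires that it exceeds `(1 - 2ε)k`. By Hoeffding's
inequality a hypothesis is accurate for at most a fraction `exp (-k (1 - 2ε)² / 2)` of the
targets, so averaging over the targets gives `1 - δ ≤ 2 ^ s * exp (-k (1 - 2ε)² / 2)`.
-/

namespace RobustPAC

open ProbabilityTheory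
open scoped ENNReal Finset

theorem exists_shatters_of_lt_vcDim {X : Type*} {H : Set (X → Bool)} {n : ℕ}
    (h : (n : ℕ∞) < vcDim H) : ∃ S : Finset X, Shatters H S ∧ n < #S := by
  simp only [vcDim, lt_iSup_iff] at h
  obtain ⟨S, hS, hn⟩ := h
  exact ⟨S, hS, by exact_mod_cast hn⟩

theorem Shatters.exists_forall_eq {X ι : Type*} [Finite ι] {H : Set (X → Bool)} {S : Finset X}
    (hS : Shatters H S) (e : ι ↪ S) (f : ι → Bool) : ∃ c ∈ H, ∀ i, c (e i) = f i := by
  classical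
  have := Fintype.ofFinite ι
  obtain ⟨c, hc, hcS⟩ := hS (({i | f i = true} : Finset ι).image fun i => (e i : X))
    (Finset.image_subset_iff.2 fun i _ => (e i).2)
  refine ⟨c, hc, fun i => ?_⟩
  rw [Bool.eq_iff_iff, hcS _ (e i).2]
  simp

theorem exists_forall_labelling_of_card_le_vcDim {X ι : Type*} [Fintype ι] [Nonempty ι]
    {H : Set (X → Bool)} (h : (Fintype.card ι : ℕ∞) ≤ vcDim H) :
    ∃ g : ι → X, ∀ f : ι → Bool, ∃ c ∈ H, ∀ i, c (g i) = f i := by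
  have hpos : 0 < Fintype.card ι := Fintype.card_pos
  have hlt : ((Fintype.card ι - 1 : ℕ) : ℕ∞) < vcDim H :=
    lt_of_lt_of_le (by exact_mod_cast Nat.sub_one_lt hpos.ne') h
  obtain ⟨S, hS, hcard⟩ := exists_shatters_of_lt_vcDim hlt
  obtain ⟨e⟩ : Nonempty (ι ↪ S) :=
    Function.Embedding.nonempty_of_card_le (by rw [Fintype.card_coe]; omega)
  exact ⟨fun i => e i, hS.exists_forall_eq e⟩

theorem sum_bool_exp_mul_le {z : Bool → ℝ} (hz : ∀ b, z (!b) = -z b) (hz1 : ∀ b, |z b| ≤ 1)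
    (γ : ℝ) : ∑ b, Real.exp (γ * z b) ≤ 2 * Real.exp (γ ^ 2 / 2) := by
  have hsq : (γ * z true) ^ 2 ≤ γ ^ 2 := by
    rw [mul_pow]
    exact mul_le_of_le_one_right (sq_nonneg γ) ((sq_le_one_iff_abs_le_one _).2 (hz1 true))
  calc ∑ b, Real.exp (γ * z b) = 2 * Real.cosh (γ * z true) := by
        rw [Fintype.sum_bool, ← Bool.not_true, hz, Real.cosh_eq, mul_neg]
        ring
    _ ≤ 2 * Real.exp ((γ * z true) ^ 2 / 2) := by gcongr; exact Real.cosh_le_exp_half_sq _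
    _ ≤ 2 * Real.exp (γ ^ 2 / 2) := by gcongr

/-- Hoeffding's inequality for independent symmetric variables, in counting form. -/
theorem card_mul_card_le_sum_le_two_pow_mul_exp {ι : Type*} [Fintype ι] [DecidableEq ι]
    {z : ι → Bool → ℝ} (hz : ∀ i b, z i (!b) = -z i b) (hz1 : ∀ i b, |z i b| ≤ 1)
    {γ : ℝ} (hγ : 0 ≤ γ) :
    (#{b : ι → Bool | γ * Fintype.card ι ≤ ∑ i, z i (b i)} : ℝ)
      ≤ 2 ^ Fintype.card ι * Real.exp (-(Fintype.card ι * γ ^ 2 / 2)) := by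
  set k := Fintype.card ι
  have hmgf : ∑ b : ι → Bool, Real.exp (γ * ∑ i, z i (b i))
      ≤ (2 * Real.exp (γ ^ 2 / 2)) ^ k := by
    calc ∑ b : ι → Bool, Real.exp (γ * ∑ i, z i (b i))
        = ∏ i, ∑ b, Real.exp (γ * z i b) := by
          simp only [Fintype.prod_sum, Finset.mul_sum, Real.exp_sum]
      _ ≤ ∏ _i : ι, 2 * Real.exp (γ ^ 2 / 2) :=
          Finset.prod_le_prod (fun _ _ => by positivity)
            fun i _ => sum_bool_exp_mul_le (hz i) (hz1 i) γ
      _ = (2 * Real.exp (γ ^ 2 / 2)) ^ k := by rw [Finset.prod_const, Finset.card_univ]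
  have hmarkov : #{b : ι → Bool | γ * k ≤ ∑ i, z i (b i)} * Real.exp (γ * (γ * k))
      ≤ ∑ b : ι → Bool, Real.exp (γ * ∑ i, z i (b i)) := by
    rw [← nsmul_eq_mul]
    refine (Finset.card_nsmul_le_sum _ (fun b => Real.exp (γ * ∑ i, z i (b i))) _
      fun b hb => ?_).trans (Finset.sum_le_univ_sum_of_nonneg fun b => by positivity)
    have := (Finset.mem_filter.1 hb).2
    gcongr
  rw [← mul_le_mul_iff_left₀ (Real.exp_pos (γ * (γ * k)))]
  refine (hmarkov.trans hmgf).trans_eq ?_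
  rw [mul_pow, ← Real.exp_nat_mul, mul_assoc, ← Real.exp_add]
  ring_nf

/-- The advantage over guessing of the predictions `f` for the two points of a pair, one of which is
positive and one negative, if `b` is the positive one: it is `1` minus the number of mistakes. -/
def advantage (f : Bool → Bool) (b : Bool) : ℝ := (f b).toNat - (f !b).toNat

theorem advantage_not (f : Bool → Bool) (b : Bool) : advantage f (!b) = -advantage f b := by
  simp [advantage]

theorem abs_advantage_le_one (f : Bool → Bool) (b : Bool) : |advantage f b| ≤ 1 := by
  unfold advantage
  cases f b <;> cases f !b <;> simp

theorem advantage_eq_one_sub (f : Bool → Bool) (b : Bool) :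
    advantage f b = 1 - (if f b = false then 1 else 0) - (if f (!b) = true then 1 else 0) := by
  unfold advantage
  cases f b <;> cases f !b <;> simp

/-- The empirical distribution of a finite family of points: the law of `x i` for a uniformly random
index `i`. It serves as the distribution from which a faithful oracle draws. -/
noncomputable def empirical {X : Type*} [MeasurableSpace X] {k : ℕ} (x : Fin k → X) : Measure X :=
  (uniformOn Set.univ).map x

section Empirical

variable {X : Type*} [MeasurableSpace X] {k : ℕ}

instance isProbabilityMeasure_empirical [NeZero k] (x : Fin k → X) :
    IsProbabilityMeasure (empirical x) :=
  Measure.isProbabilityMeasure_map (measurable_of_finite x).aemeasurable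

theorem card_div_le_empirical (x : Fin k → X) (B : Set X) [DecidablePred (· ∈ B)] :
    (#{i | x i ∈ B} : ℝ≥0∞) / k ≤ empirical x B := by
  refine le_trans (le_of_eq ?_) (Measure.le_map_apply (measurable_of_finite x).aemeasurable B)
  rw [uniformOn_univ, Fintype.card_fin, ← Measure.count_apply_finset]
  congr 2
  ext i
  simp

theorem empirical_eq_one [NeZero k] {x : Fin k → X} {B : Set X} (h : ∀ i, x i ∈ B) :
    empirical x B = 1 := by
  classical
  refine le_antisymm prob_le_one ((le_of_eq ?_).trans (card_div_le_empirical x B))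
  simp [h, ENNReal.div_self (NeZero.ne (k : ℝ≥0∞))]

theorem card_lt_of_empirical_lt [NeZero k] {x : Fin k → X} {B : Set X} [DecidablePred (· ∈ B)]
    {ε : ℝ} (h : empirical x B < ENNReal.ofReal ε) : (#{i | x i ∈ B} : ℝ) < ε * k := by
  have hk : (0 : ℝ) < k := by exact_mod_cast Nat.pos_of_neZero k
  have hlt := (card_div_le_empirical x B).trans_lt h
  rw [← ENNReal.ofReal_natCast, ← ENNReal.ofReal_natCast k, ← ENNReal.ofReal_div_of_pos hk,
    ENNReal.ofReal_lt_ofReal_iff_of_nonneg (by positivity)] at hlt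
  exact (div_lt_iff₀ hk).1 hlt

theorem ErrorLT.lt_sum_advantage [NeZero k] {g : Fin k × Bool → X} {b : Fin k → Bool}
    {h : X → Bool} {ε : ℝ}
    (herr : ErrorLT (empirical fun i => g (i, b i)) (empirical fun i => g (i, !b i)) h ε) :
    (1 - 2 * ε) * k < ∑ i, advantage (fun v => h (g (i, v))) (b i) := by
  have hpos : (#{i | h (g (i, b i)) = false} : ℝ) < ε * k := card_lt_of_empirical_lt herr.1
  have hneg : (#{i | h (g (i, !b i)) = true} : ℝ) < ε * k := card_lt_of_empirical_lt herr.2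
  have hsum : ∑ i, advantage (fun v => h (g (i, v))) (b i)
      = k - #{i | h (g (i, b i)) = false} - #{i | h (g (i, !b i)) = true} := by
    simp [advantage_eq_one_sub, Finset.sum_sub_distrib]
  linarith

theorem card_errorLT_le [NeZero k] (g : Fin k × Bool → X) (h : X → Bool) {ε : ℝ}
    (hε : ε ≤ 1 / 2) {T : Finset (Fin k → Bool)}
    (hT : ∀ b ∈ T, ErrorLT (empirical fun i => g (i, b i)) (empirical fun i => g (i, !b i)) h ε) :
    (#T : ℝ) ≤ 2 ^ k * Real.exp (-(k * (1 - 2 * ε) ^ 2 / 2)) := by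
  have hoeffding := card_mul_card_le_sum_le_two_pow_mul_exp
    (fun i : Fin k => advantage_not fun v => h (g (i, v)))
    (fun i => abs_advantage_le_one fun v => h (g (i, v))) (γ := 1 - 2 * ε) (by linarith)
  rw [Fintype.card_fin] at hoeffding
  refine le_trans ?_ hoeffding
  gcongr
  exact fun b hb => Finset.mem_filter.2 ⟨Finset.mem_univ b, (hT b hb).lt_sum_advantage.le⟩

end Empirical

theorem card_le_add_sum_measure {Ω ι : Type*} [Fintype ι] [MeasurableSpace Ω] (P : Measure Ω)
    [IsProbabilityMeasure P] (B : ι → Set Ω) [∀ ω, DecidablePred fun b => ω ∉ B b] {N : ℝ≥0∞}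
    (hN : ∀ ω, (#{b | ω ∉ B b} : ℝ≥0∞) ≤ N) :
    (Fintype.card ι : ℝ≥0∞) ≤ N + ∑ b, P (B b) := by
  classical
  let M b := toMeasurable P (B b)
  have hM b : MeasurableSet (M b) := measurableSet_toMeasurable P (B b)
  have hpointwise ω : (Fintype.card ι : ℝ≥0∞) ≤ N + ∑ b, (M b).indicator 1 ω := by
    have hsplit : Fintype.card ι = #{b | ω ∉ B b} + #{b | ω ∈ B b} := by
      rw [← Finset.card_univ, ← Finset.card_filter_add_card_filter_not (fun b => ω ∉ B b)]
      simp only [not_not]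
    rw [hsplit, Nat.cast_add, Finset.card_filter (fun b => ω ∈ B b), Nat.cast_sum]
    gcongr with b
    · exact hN ω
    · by_cases hb : ω ∈ B b
      · simp [hb, Set.indicator_of_mem (subset_toMeasurable P (B b) hb), M]
      · simp [hb]
  calc (Fintype.card ι : ℝ≥0∞) = ∫⁻ _, Fintype.card ι ∂P := by simp
    _ ≤ ∫⁻ ω, N + ∑ b, (M b).indicator 1 ω ∂P := lintegral_mono hpointwise
    _ = N + ∑ b, P (B b) := by
      rw [lintegral_add_left measurable_const, lintegral_finsetSum _ fun b _ =>
        measurable_one.indicator (hM b)]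
      simp [lintegral_indicator_one (hM _), M, measure_toMeasurable]

/-- A randomly chosen finite family of hypotheses, of law `P` and indexed by `Q`, is a probabilistic
representation of the class `H` with error rate `ε` and failure probability `δ` if for every target
in `H` and all distributions of its positive and of its negative examples, the family contains a
hypothesis with error less than `ε`, except with probability at most `δ`. This is the notion of
Beimel, Nissim and Stemmer, for separate oracles for the two labels. The hypotheses need not belong
to `H`. -/
def IsProbabilisticRepresentation {X Ω Q : Type*} [MeasurableSpace X] [MeasurableSpace Ω]
    (P : Measure Ω) (H : Set (X → Bool)) (F : Ω → Q → X → Bool) (ε δ : ℝ) : Prop :=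
  ∀ c ∈ H, ∀ Dpos Dneg : Measure X, IsProbabilityMeasure Dpos → IsProbabilityMeasure Dneg →
    Dpos {x | c x = true} = 1 → Dneg {x | c x = false} = 1 →
    P {ω | ∀ q, ¬ ErrorLT Dpos Dneg (F ω q) ε} ≤ ENNReal.ofReal δ

section LowerBound

variable {X Ω : Type*} [MeasurableSpace X] [MeasurableSpace Ω] {P : Measure Ω}
  {H : Set (X → Bool)} {ε δ : ℝ}

theorem IsProbabilisticRepresentation.one_sub_le_card_mul_exp [IsProbabilityMeasure P]
    {Q : Type*} [Fintype Q] {F : Ω → Q → X → Bool} (hF : IsProbabilisticRepresentation P H F ε δ)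
    (hε : ε ≤ 1 / 2) (hδ : 0 ≤ δ) {k : ℕ} [NeZero k] (hk : ((k * 2 : ℕ) : ℕ∞) ≤ vcDim H) :
    1 - δ ≤ Fintype.card Q * Real.exp (-(k * (1 - 2 * ε) ^ 2 / 2)) := by
  classical
  obtain ⟨g, hg⟩ := exists_forall_labelling_of_card_le_vcDim (ι := Fin k × Bool) (H := H)
    (by simpa using hk)
  let Accurate (b : Fin k → Bool) (h : X → Bool) : Prop :=
    ErrorLT (empirical fun i => g (i, b i)) (empirical fun i => g (i, !b i)) h ε
  let Fail (b : Fin k → Bool) : Set Ω := {ω | ∀ q, ¬ Accurate b (F ω q)}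
  let E : ℝ := Real.exp (-(k * (1 - 2 * ε) ^ 2 / 2))
  have hfail b : P (Fail b) ≤ ENNReal.ofReal δ := by
    obtain ⟨c, hc, hcg⟩ := hg fun p => p.2 == b p.1
    exact hF c hc _ _ inferInstance inferInstance
      (empirical_eq_one fun i => by simp [hcg]) (empirical_eq_one fun i => by simp [hcg])
  have hcover ω : #{b | ω ∉ Fail b} ≤ Fintype.card Q * (2 ^ k * E) := by
    calc (#{b | ω ∉ Fail b} : ℝ)
        = #(Finset.univ.biUnion fun q => ({b | Accurate b (F ω q)} : Finset (Fin k → Bool))) := by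
          congr 2
          ext b
          simp [Fail]
      _ ≤ ∑ q, (#{b | Accurate b (F ω q)} : ℝ) := by exact_mod_cast Finset.card_biUnion_le
      _ ≤ ∑ _q : Q, 2 ^ k * E := Finset.sum_le_sum fun q _ =>
          card_errorLT_le g (F ω q) hε fun b hb => (Finset.mem_filter.1 hb).2
      _ = Fintype.card Q * (2 ^ k * E) := by simp
  have haverage : (2 : ℝ) ^ k ≤ Fintype.card Q * (2 ^ k * E) + 2 ^ k * δ := by
    have hsum := (card_le_add_sum_measure P Fail fun ω =>
      (ENNReal.ofReal_natCast _).symm.trans_le (ENNReal.ofReal_le_ofReal (hcover ω))).trans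
        (add_le_add_right (Finset.sum_le_sum fun b _ => hfail b) _)
    rw [← ENNReal.ofReal_natCast, ← ENNReal.ofReal_sum_of_nonneg fun _ _ => hδ,
      ← ENNReal.ofReal_add (by positivity) (Finset.sum_nonneg fun _ _ => hδ),
      ENNReal.ofReal_le_ofReal_iff (by positivity)] at hsum
    simpa using hsum
  refine le_of_mul_le_mul_left ?_ (pow_pos (two_pos (α := ℝ)) k)
  linarith

theorem isProbabilityMeasure_coin {lam : ℝ} (h₀ : 0 ≤ lam) (h₁ : lam ≤ 1) :
    IsProbabilityMeasure (coin lam) :=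
  ⟨by simp [coin, ← ENNReal.ofReal_add h₀ (sub_nonneg.2 h₁)]⟩

theorem IsRobustPACLearner.isProbabilisticRepresentation {r s m : ℕ} {A : StreamLearner Ω H s}
    {lam : ℝ} (hA : IsRobustPACLearner P A r m ε δ lam) (h₀ : 0 ≤ lam) (h₁ : lam ≤ 1) :
    IsProbabilisticRepresentation P H (fun ω q => (A.out ω q : X → Bool)) ε δ := by
  intro c hc Dpos Dneg _ _ hpos hneg
  have := isProbabilityMeasure_coin h₀ h₁
  have : IsProbabilityMeasure (drawLaw lam Dpos Dneg m) := by unfold drawLaw; infer_instance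
  have : Nonempty X := nonempty_of_isProbabilityMeasure Dpos
  let adv : Adversary X s := fun _ _ _ => Classical.arbitrary X
  calc P {ω | ∀ q, ¬ ErrorLT Dpos Dneg (A.out ω q) ε}
      = (P.prod (drawLaw lam Dpos Dneg m))
          ({ω | ∀ q, ¬ ErrorLT Dpos Dneg (A.out ω q) ε} ×ˢ Set.univ) := by
        rw [Measure.prod_prod, measure_univ, mul_one]
    _ ≤ (P.prod (drawLaw lam Dpos Dneg m))
          {w | ¬ ErrorLT Dpos Dneg (output A adv w.1 (List.ofFn w.2) r) ε} :=
        measure_mono fun _ hw => hw.1 _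
    _ ≤ ENNReal.ofReal δ := hA c hc Dpos Dneg inferInstance inferInstance hpos hneg adv

theorem IsRobustPACLearner.mul_sq_add_log_le [IsProbabilityMeasure P] {r s m : ℕ}
    {A : StreamLearner Ω H s} {lam : ℝ} (hA : IsRobustPACLearner P A r m ε δ lam)
    (h₀ : 0 ≤ lam) (h₁ : lam ≤ 1) (hε : ε ≤ 1 / 2) (hδ₀ : 0 ≤ δ) (hδ₁ : δ < 1)
    {k : ℕ} [NeZero k] (hk : ((k * 2 : ℕ) : ℕ∞) ≤ vcDim H) :
    k * (1 - 2 * ε) ^ 2 / 2 + Real.log (1 - δ) ≤ s * Real.log 2 := by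
  have hcard :=
    (hA.isProbabilisticRepresentation h₀ h₁).one_sub_le_card_mul_exp hε hδ₀ hk
  have hlog := Real.log_le_log (sub_pos.2 hδ₁) hcard
  rw [Real.log_mul (by simp) (Real.exp_ne_zero _), Real.log_exp] at hlog
  have hmemory : Real.log (Fintype.card (Memory s)) = s * Real.log 2 := by simp
  linarith

end LowerBound

theorem accuracy_ratio_mul_div_le {ε lam : ℝ} (hε : ε < 1) (hlam : lam ≤ ε) (d : ℕ) {r : ℕ}
    (hr : 1 ≤ r) : (1 - ε) / (1 - lam) * ((d : ℝ) / r) ≤ d := by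
  have hratio : (1 - ε) / (1 - lam) ≤ 1 := (div_le_one (by linarith)).2 (by linarith)
  have hdiv : (d : ℝ) / r ≤ d := div_le_self (Nat.cast_nonneg d) (by exact_mod_cast hr)
  exact (mul_le_of_le_one_left (by positivity) hratio).trans hdiv

end RobustPAC

open RobustPAC in
theorem theorem5_general (ε₀ : ℝ) (hε₀ : ε₀ < 1 / 2) :
    ∃ c : ℝ, 0 < c ∧ ∀ δ : ℝ, 0 ≤ δ → δ < 1 → ∃ d₀ : ℕ,
    ∀ ε lam : ℝ, ε ≤ ε₀ → 0 ≤ lam → lam ≤ 1 →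
    ∀ (X : Type*) [MeasurableSpace X] (H : Set (X → Bool)),
    ∀ d : ℕ, d₀ ≤ d → (d : ℕ∞) ≤ vcDim H →
    ∀ (Ω : Type*) [MeasurableSpace Ω] (P : Measure Ω), IsProbabilityMeasure P →
    ∀ (r s m : ℕ) (A : StreamLearner Ω H s), IsRobustPACLearner P A r m ε δ lam →
      c * d ≤ s := by
  have hγ : 0 < (1 - 2 * ε₀) ^ 2 := pow_pos (by linarith) 2
  -- Half of the exponent `d * (1 - 2 * ε₀) ^ 2 / 8` pays for `log (1 - δ)`.
  refine ⟨(1 - 2 * ε₀) ^ 2 / 16, by positivity, fun δ hδ₀ hδ₁ => ?_⟩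
  obtain ⟨n, hn⟩ := exists_nat_ge (-Real.log (1 - δ) / ((1 - 2 * ε₀) ^ 2 / 16))
  refine ⟨n + 2, fun ε lam hε h₀ h₁ X _ H d hd hVC Ω _ P _ r s m A hA => ?_⟩
  have : NeZero (d / 2) := ⟨by omega⟩
  have hlower := hA.mul_sq_add_log_le h₀ h₁ (hε.trans hε₀.le) hδ₀ hδ₁ (k := d / 2)
    (le_trans (by exact_mod_cast Nat.div_mul_le_self d 2) hVC)
  have hhalf : (d : ℝ) / 4 ≤ (d / 2 : ℕ) := by
    rw [div_le_iff₀ four_pos]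
    exact_mod_cast (by omega : d ≤ d / 2 * 4)
  have hdelta : -Real.log (1 - δ) ≤ d * ((1 - 2 * ε₀) ^ 2 / 16) :=
    (div_le_iff₀ (by positivity)).1 (hn.trans (by exact_mod_cast (by omega : n ≤ d)))
  have hrate : (d : ℝ) / 4 * (1 - 2 * ε₀) ^ 2 ≤ (d / 2 : ℕ) * (1 - 2 * ε) ^ 2 := by
    gcongr
    linarith
  have hbits : s * Real.log 2 ≤ s :=
    mul_le_of_le_one_right (Nat.cast_nonneg s) (Real.log_two_lt_d9.le.trans (by norm_num))
  linarith

/-- Space lower bound for `r`-pass online robust PAC learning. For error rates `ε` in a range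
`(0, ε₀]` with `ε₀ < 1/2`, the constant `c` of the bound depends on `ε₀` only, and the bound holds
as soon as `d` exceeds a threshold that depends on `ε₀` and the failure probability `δ` only.
If `H` has finite VC-dimension, the strongest case is that where `d` is the VC-dimension; if the
VC-dimension is infinite, then the bound for all `d` says that no space suffices. -/
theorem theorem5 :
    ∀ ε₀ : ℝ, ε₀ < 1 / 2 →
    ∃ c : ℝ, 0 < c ∧
    ∀ δ : ℝ, 0 < δ → δ < 1 →
    ∃ d₀ : ℕ,
    ∀ (ε lam : ℝ), 0 < ε → ε ≤ ε₀ → 0 ≤ lam → lam < ε →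
    ∀ (X : Type*) [MeasurableSpace X] (H : Set (X → Bool)), (∀ h ∈ H, Measurable h) →
    ∀ d : ℕ, d₀ ≤ d → (d : ℕ∞) ≤ RobustPAC.vcDim H →
    ∀ (Ω : Type*) [MeasurableSpace Ω] (P : Measure Ω), IsProbabilityMeasure P →
    ∀ (r s m : ℕ), 1 ≤ r →
    ∀ A : RobustPAC.StreamLearner Ω H s,
      RobustPAC.IsRobustPACLearner P A r m ε δ lam →
      c * ((1 - ε) / (1 - lam) * ((d : ℝ) / (r : ℝ))) ≤ (s : ℝ) := by
  intro ε₀ hε₀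
  obtain ⟨c, hc, hbound⟩ := theorem5_general ε₀ hε₀
  refine ⟨c, hc, fun δ hδ₀ hδ₁ => (hbound δ hδ₀.le hδ₁).imp fun d₀ hd₀ => ?_⟩
  intro ε lam _ hε hlam₀ hlam X _ H _ d hd hVC Ω _ P hP r s m hr A hA
  exact (mul_le_mul_of_nonneg_left
    (RobustPAC.accuracy_ratio_mul_div_le (by linarith) hlam.le d hr) hc.le).trans
    (hd₀ ε lam hε hlam₀ (by linarith) X H d hd hVC Ω P hP r s m A hA)
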